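/- Let $n\ge 2$. For a sequence $(X_m,x_m)_{m\in\mathbb N}$ of path-connected based topological spaces, let $W_X=\widetilde{\bigvee}_m X_m$ be its shrinking wedge, i.e. the one-point union of the $X_m$ along their basepoints $x_m$ (with common basepoint $x_0$), where $U\subseteq W_X$ is open iff $U\cap X_m$ is open in $X_m$ for every $m$ and, if $x_0\in U$, then $X_m\subseteq U$ for all but finitely many $m$. Let $\sigma\colon W_X\to\prod_m X_m$ be the canonical embedding, through which $W_X$ is regarded as a subspace of $\prod_m X_m$, and let $\partial\colon \pi_{n+1}(\prod_m X_m, W_X)\to\pi_n(W_X)$ be the boundary map of the long exact homotopy sequence of the pair. All homotopy groups are taken at the canonical basepoints. Then there are group isomorphisms $$\Phi_X\colon \pi_n\Big(\widetilde{\bigvee}_m X_m\Big)\;\xrightarrow{\ \cong\ }\;\pi_{n+1}\Big(\prod_m X_m,\ \widetilde{\bigvee}_m X_m\Big)\oplus\prod_m \pi_n(X_m),$$ one for every such sequence, that are natural: for every sequence of based maps $f_m\colon (X_m,x_m)\to (Y_m,y_m)$, $\Phi_X$ and $\Phi_Y$ commute with the homomorphisms induced by $(f_m)$ on both sides. Moreover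 $\Phi_X$ splits the long exact sequence of the pair: $\Phi_X^{-1}(\alpha,0)=\partial\alpha$ for all $\alpha\in\pi_{n+1}(\prod_m X_m,W_X)$, and the second component of $\Phi_X(\beta)$ is $\sigma_\#(\beta)$ under the canonical identification $\pi_n(\prod_m X_m)=\prod_m\pi_n(X_m)$. -/

import Mathlib

open scoped unitInterval Topology Topology.Homotopy

universe u

noncomputable section

/-! ### Induced maps on homotopy groups -/

namespace HomotopyGroup

/-- The map `φ_# : π_N(X, x) → π_N(Y, y)`, `[f] ↦ [φ ∘ f]`, induced by a continuous map `φ` with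
`φ x = y`. -/
def map {N X Y : Type*} [TopologicalSpace X] [TopologicalSpace Y] {x : X} {y : Y}
    (φ : C(X, Y)) (h : φ x = y) : HomotopyGroup N X x → HomotopyGroup N Y y :=
  Quotient.map
    (fun f : Ω^ N X x => (⟨φ.comp f.1, fun z hz => by
      rw [ContinuousMap.comp_apply, f.2 z hz, h]⟩ : Ω^ N Y y))
    (fun _ _ H => ContinuousMap.HomotopicRel.comp_continuousMap H φ)

end HomotopyGroup

/-! ### Relative homotopy groups -/

/-- A map `f : I^N × I → X` is a relative cube of the pair `(X, A)` based at `x` if it maps the face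
`I^N × {0}` into `A`, and maps the union `J` of all the other faces, that is
`∂(I^N) × I ∪ I^N × {1}`, to `x`. -/
def IsRelCube {N X : Type*} [TopologicalSpace X] (A : Set X) (x : X) (f : C((I^N) × I, X)) : Prop :=
  (∀ y, f (y, 0) ∈ A) ∧ (∀ y, f (y, 1) = x) ∧ ∀ y ∈ Cube.boundary N, ∀ t, f (y, t) = x

/-- Relative cubes `(I^N × I, ∂(I^N × I), J) → (X, A, x)`. -/
def RelCube (N : Type*) {X : Type*} [TopologicalSpace X] (A : Set X) (x : X) : Type _ :=
  {f : C((I^N) × I, X) // IsRelCube A x f}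

/-- Two relative cubes are equivalent if they are homotopic through relative cubes. -/
instance RelCube.setoid (N : Type*) {X : Type*} [TopologicalSpace X] (A : Set X) (x : X) :
    Setoid (RelCube N A x) where
  r f g := f.1.HomotopicWith g.1 (IsRelCube A x)
  iseqv :=
    ⟨fun f => ContinuousMap.HomotopicWith.refl f.1 f.2,
      fun h => ContinuousMap.HomotopicWith.symm h,
      fun h k => ContinuousMap.HomotopicWith.trans h k⟩

/-- The relative homotopy group: homotopy classes of relative cubes
`(I^N × I, ∂(I^N × I), J) → (X, A, x)`. For `N = Fin n`, so that `I^N × I = I^(n+1)`, this is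
`π_{n+1}(X, A, x)`. -/
def RelHomotopyGroup (N : Type*) {X : Type*} [TopologicalSpace X] (A : Set X) (x : X) : Type _ :=
  Quotient (RelCube.setoid N A x)

/-- The space of paths in `X` that start in `A` and end at `x`, with the compact-open topology. -/
abbrev RelPathSpace {X : Type*} [TopologicalSpace X] (A : Set X) (x : X) : Type _ :=
  {γ : C(I, X) // γ 0 ∈ A ∧ γ 1 = x}

/-- The constant path at `x ∈ A`. -/
def RelPathSpace.const {X : Type*} [TopologicalSpace X] {A : Set X} {x : X} (hx : x ∈ A) :
    RelPathSpace A x :=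
  ⟨ContinuousMap.const I x, hx, rfl⟩

section Adjunction

variable {N X : Type*} [TopologicalSpace X] {A : Set X} {x : X}

/-- Relative cubes in `(X, A, x)` are the same as `N`-dimensional loops in the space of paths
from `A` to `x`. -/
def relCubeEquiv (N : Type*) {X : Type*} [TopologicalSpace X] {A : Set X} {x : X} (hx : x ∈ A) :
    RelCube N A x ≃ Ω^ N (RelPathSpace A x) (RelPathSpace.const hx) where
  toFun f := ⟨⟨fun y => ⟨f.1.curry y, f.2.1 y, f.2.2.1 y⟩, by fun_prop⟩, fun y hy =>
    Subtype.ext (ContinuousMap.ext fun t => f.2.2.2 y hy t)⟩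
  invFun g := ⟨ContinuousMap.uncurry ⟨fun y => (g.1 y).1, by fun_prop⟩,
    fun y => (g.1 y).2.1, fun y => (g.1 y).2.2, fun y hy t => by
      have := g.2 y hy
      exact congrArg (fun γ : RelPathSpace A x => γ.1 t) this⟩
  left_inv f := Subtype.ext (ContinuousMap.ext fun _ => rfl)
  right_inv g := GenLoop.ext _ _ fun _ => Subtype.ext (ContinuousMap.ext fun _ => rfl)

theorem relCubeEquiv_apply (hx : x ∈ A) (f : RelCube N A x) (y : I^N) (t : I) :
    (relCubeEquiv N hx f y).1 t = f.1 (y, t) :=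
  rfl

theorem relCubeEquiv_homotopic (hx : x ∈ A) (f g : RelCube N A x) :
    f ≈ g ↔ GenLoop.Homotopic (relCubeEquiv N hx f) (relCubeEquiv N hx g) := by
  constructor
  · rintro ⟨H⟩
    have hH : ∀ s : I, IsRelCube A x ⟨fun z => H (s, z), by fun_prop⟩ := H.prop'
    let K : C(I × (I^N), C(I, X)) :=
      ContinuousMap.curry ⟨fun p => H (p.1.1, (p.1.2, p.2)), by fun_prop⟩
    refine ⟨⟨⟨⟨fun p => ⟨K p, (hH p.1).1 p.2, (hH p.1).2.1 p.2⟩, by fun_prop⟩, ?_, ?_⟩, ?_⟩⟩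
    · exact fun y => Subtype.ext (ContinuousMap.ext fun t => H.apply_zero (y, t))
    · exact fun y => Subtype.ext (ContinuousMap.ext fun t => H.apply_one (y, t))
    · intro s y hy
      refine Subtype.ext (ContinuousMap.ext fun t => ?_)
      exact ((hH s).2.2 y hy t).trans (f.2.2.2 y hy t).symm
  · rintro ⟨H⟩
    let K : C((I × (I^N)) × I, X) :=
      ContinuousMap.uncurry ⟨fun p => (H p).1, by fun_prop⟩
    refine ⟨⟨⟨⟨fun p => K ((p.1, p.2.1), p.2.2), by fun_prop⟩, ?_, ?_⟩, ?_⟩⟩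
    · rintro ⟨y, t⟩
      exact congrArg (fun γ : RelPathSpace A x => γ.1 t) (H.apply_zero y)
    · rintro ⟨y, t⟩
      exact congrArg (fun γ : RelPathSpace A x => γ.1 t) (H.apply_one y)
    · intro s
      refine ⟨fun y => (H (s, y)).2.1, fun y => (H (s, y)).2.2, fun y hy t => ?_⟩
      have h1 := congrArg (fun γ : RelPathSpace A x => γ.1 t) (H.eq_fst s hy)
      exact h1.trans (f.2.2.2 y hy t)

/-- The induced bijection between the relative homotopy group of `(X, A, x)` and the homotopy group
of the space of paths from `A` to `x`. -/
def relHomotopyGroupEquiv (N : Type*) {X : Type*} [TopologicalSpace X] {A : Set X} {x : X}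
    (hx : x ∈ A) :
    RelHomotopyGroup N A x ≃ HomotopyGroup N (RelPathSpace A x) (RelPathSpace.const hx) :=
  Quotient.congr (relCubeEquiv N hx) (relCubeEquiv_homotopic hx)

/-- The group structure on the relative homotopy group, given by concatenation of relative cubes
along any of the coordinates of `I^N` (see `RelHomotopyGroup.mul_spec`). -/
instance RelHomotopyGroup.group [DecidableEq N] [Nonempty N] [hx : Fact (x ∈ A)] :
    Group (RelHomotopyGroup N A x) :=
  (relHomotopyGroupEquiv N hx.out).group

/-- The product of the classes of `f` and `g` is represented by every relative cube which is
the concatenation of `f` and `g` along the coordinate `i` of `I^N` (with the order of the factors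
that Mathlib uses for homotopy groups). -/
theorem RelHomotopyGroup.mul_spec [DecidableEq N] [Nonempty N] [hx : Fact (x ∈ A)] (i : N)
    (f g h : RelCube N A x)
    (hh : ∀ (y : I^N) (t : I), h.1 (y, t) = if (y i : ℝ) ≤ 1 / 2
      then g.1 (Function.update y i (Set.projIcc 0 1 zero_le_one (2 * (y i : ℝ))), t)
      else f.1 (Function.update y i (Set.projIcc 0 1 zero_le_one (2 * (y i : ℝ) - 1)), t)) :
    ((· * ·) : RelHomotopyGroup N A x → RelHomotopyGroup N A x → RelHomotopyGroup N A x)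
      (Quotient.mk _ f) (Quotient.mk _ g) = Quotient.mk _ h := by
  apply (relHomotopyGroupEquiv N hx.out).injective
  have h1 : relCubeEquiv N hx.out h
      = GenLoop.transAt i (relCubeEquiv N hx.out g) (relCubeEquiv N hx.out f) := by
    refine GenLoop.ext _ _ fun y => Subtype.ext (ContinuousMap.ext fun t => ?_)
    rw [relCubeEquiv_apply, hh]
    simp only [GenLoop.transAt, GenLoop.coe_copy]
    split_ifs <;> rfl
  have h2 := HomotopyGroup.mul_spec (i := i) (p := relCubeEquiv N hx.out f)
    (q := relCubeEquiv N hx.out g)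
  refine ((relHomotopyGroupEquiv N hx.out).apply_symm_apply _).trans (h2.trans ?_)
  rw [← h1]
  rfl

end Adjunction

namespace RelHomotopyGroup

/-- The map `φ_# : π(X, A, x) → π(Y, B, y)`, `[f] ↦ [φ ∘ f]`, induced by a map of pairs `φ` with
`φ x = y`. -/
def map {N X Y : Type*} [TopologicalSpace X] [TopologicalSpace Y] {A : Set X} {B : Set Y}
    {x : X} {y : Y} (φ : C(X, Y)) (hφ : Set.MapsTo φ A B) (h : φ x = y) :
    RelHomotopyGroup N A x → RelHomotopyGroup N B y :=
  Quotient.map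
    (fun f : RelCube N A x => (⟨φ.comp f.1, fun z => hφ (f.2.1 z),
      fun z => (congrArg φ (f.2.2.1 z)).trans h,
      fun z hz t => (congrArg φ (f.2.2.2 z hz t)).trans h⟩ : RelCube N B y))
    (by
      rintro f g ⟨H⟩
      exact ⟨⟨(ContinuousMap.Homotopy.refl φ).comp H.toHomotopy, fun s =>
        ⟨fun z => hφ ((H.prop' s).1 z), fun z => (congrArg φ ((H.prop' s).2.1 z)).trans h,
          fun z hz t => (congrArg φ ((H.prop' s).2.2 z hz t)).trans h⟩⟩⟩)

/-- The boundary map `∂ : π_{n+1}(X, A, x) → π_n(A, x)` of the long exact sequence of the pair,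
sending the class of a relative cube to the class of its restriction to the face `I^N × {0}`. -/
def boundary {N X : Type*} [TopologicalSpace X] {A : Set X} {x : X} (hx : x ∈ A) :
    RelHomotopyGroup N A x → HomotopyGroup N A ⟨x, hx⟩ :=
  Quotient.map
    (fun f : RelCube N A x => (⟨⟨fun y => ⟨f.1 (y, 0), f.2.1 y⟩, by fun_prop⟩,
      fun y hy => Subtype.ext (f.2.2.2 y hy 0)⟩ : Ω^ N A ⟨x, hx⟩))
    (by
      rintro f g ⟨H⟩
      have hH : ∀ s : I, IsRelCube A x ⟨fun z => H (s, z), by fun_prop⟩ := H.prop'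
      refine ⟨⟨⟨⟨fun p => ⟨H (p.1, (p.2, 0)), (hH p.1).1 p.2⟩, by fun_prop⟩, ?_, ?_⟩, ?_⟩⟩
      · exact fun y => Subtype.ext (H.apply_zero (y, 0))
      · exact fun y => Subtype.ext (H.apply_one (y, 0))
      · intro s y hy
        exact Subtype.ext (((hH s).2.2 y hy 0).trans (f.2.2.2 y hy 0).symm))

end RelHomotopyGroup

/-! ### The shrinking wedge -/

/-- The relation on the disjoint union of the `X m` that identifies all the basepoints `x m`. -/
def wedgeSetoid (X : ℕ → Type u) (x : ∀ m, X m) : Setoid (Σ m, X m) where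
  r a b := a = b ∨ (a.2 = x a.1 ∧ b.2 = x b.1)
  iseqv := by
    refine ⟨fun a => Or.inl rfl, ?_, ?_⟩
    · rintro a b (h | h)
      · exact Or.inl h.symm
      · exact Or.inr h.symm
    · rintro a b c (rfl | h) (rfl | k)
      · exact Or.inl rfl
      · exact Or.inr k
      · exact Or.inr h
      · exact Or.inr ⟨h.1, k.2⟩

/-- The shrinking wedge of a sequence of based spaces `(X m, x m)`: as a set, the one-point union of
the `X m` along the basepoints. -/
def ShrinkingWedge (X : ℕ → Type u) (x : ∀ m, X m) : Type u :=
  Quotient (wedgeSetoid X x)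

namespace ShrinkingWedge

variable {X Y : ℕ → Type u} {x : ∀ m, X m} {y : ∀ m, Y m}

/-- The inclusion of `X m` into the wedge. -/
def incl (X : ℕ → Type u) (x : ∀ m, X m) (m : ℕ) (a : X m) : ShrinkingWedge X x :=
  Quotient.mk (wedgeSetoid X x) ⟨m, a⟩

/-- The basepoint of the wedge, the common image of all the `x m`. -/
def base (X : ℕ → Type u) (x : ∀ m, X m) : ShrinkingWedge X x :=
  incl X x 0 (x 0)

theorem exists_incl (w : ShrinkingWedge X x) : ∃ m a, incl X x m a = w := by
  obtain ⟨⟨m, a⟩, rfl⟩ := Quotient.exists_rep w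
  exact ⟨m, a, rfl⟩

theorem incl_base (m : ℕ) : incl X x m (x m) = base X x :=
  Quotient.sound (s := wedgeSetoid X x) (Or.inr ⟨rfl, rfl⟩)

/-- The shrinking wedge topology: `U` is open if and only if `U ∩ X m` is open in `X m` for all `m`
and, in case `U` contains the basepoint, `X m ⊆ U` for all but finitely many `m`. -/
instance [∀ m, TopologicalSpace (X m)] : TopologicalSpace (ShrinkingWedge X x) where
  IsOpen U := (∀ m, IsOpen (incl X x m ⁻¹' U)) ∧
    (base X x ∈ U → {m | ¬ Set.range (incl X x m) ⊆ U}.Finite)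
  isOpen_univ := ⟨fun m => isOpen_univ, fun _ => by simp⟩
  isOpen_inter U V hU hV := by
    refine ⟨fun m => (hU.1 m).inter (hV.1 m), fun hb => ?_⟩
    refine ((hU.2 hb.1).union (hV.2 hb.2)).subset fun m hm => ?_
    by_contra hc
    simp only [Set.mem_union, Set.mem_ofPred_eq, not_or, not_not] at hc
    exact hm (Set.subset_inter hc.1 hc.2)
  isOpen_sUnion S hS := by
    refine ⟨fun m => ?_, ?_⟩
    · rw [Set.preimage_sUnion]
      exact isOpen_biUnion fun U hU => (hS U hU).1 m
    · rintro ⟨U, hU, hb⟩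
      exact ((hS U hU).2 hb).subset fun m hm hc =>
        hm (hc.trans (Set.subset_sUnion_of_mem hU))

theorem isOpen_iff [∀ m, TopologicalSpace (X m)] {U : Set (ShrinkingWedge X x)} :
    IsOpen U ↔ (∀ m, IsOpen (incl X x m ⁻¹' U)) ∧
      (base X x ∈ U → {m | ¬ Set.range (incl X x m) ⊆ U}.Finite) :=
  Iff.rfl

/-- The underlying function of the canonical embedding of the wedge into the product: `a : X m` goes
to the family with entry `a` in position `m` and the basepoint in all other positions. -/
def toProdFun (X : ℕ → Type u) (x : ∀ m, X m) : ShrinkingWedge X x → ∀ m, X m :=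
  Quotient.lift (fun a : Σ m, X m => Function.update x a.1 a.2) (by
    rintro ⟨m, a⟩ ⟨k, b⟩ (h | ⟨h, h'⟩)
    · rw [h]
    · dsimp only at h h' ⊢
      rw [h, h', Function.update_eq_self, Function.update_eq_self])

theorem toProdFun_incl (m : ℕ) (a : X m) : toProdFun X x (incl X x m a) = Function.update x m a :=
  rfl

theorem toProdFun_base : toProdFun X x (base X x) = x :=
  Function.update_eq_self 0 x

/-- The canonical embedding `σ` of the shrinking wedge into the product. -/
def toProd (X : ℕ → Type u) [∀ m, TopologicalSpace (X m)] (x : ∀ m, X m) :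
    C(ShrinkingWedge X x, ∀ m, X m) where
  toFun := toProdFun X x
  continuous_toFun := by
    refine continuous_pi fun k => continuous_def.2 fun V hV => isOpen_iff.2 ⟨fun m => ?_, fun hb => ?_⟩
    · exact hV.preimage ((continuous_apply k).comp (continuous_const.update m continuous_id))
    · refine (Set.finite_singleton k).subset fun m hm => ?_
      by_contra hmk
      apply hm
      rintro _ ⟨a, rfl⟩
      have hb' : x k ∈ V := by simpa [toProdFun_base] using hb
      have hkm : k ≠ m := fun h => hmk h.symm
      simpa [toProdFun_incl, Function.update_of_ne hkm] using hb'

theorem toProd_base [∀ m, TopologicalSpace (X m)] : toProd X x (base X x) = x :=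
  toProdFun_base

theorem toProdFun_injective : Function.Injective (toProdFun X x) := by
  rintro ⟨m, a⟩ ⟨k, b⟩ h
  change Function.update x m a = Function.update x k b at h
  apply Quotient.sound (s := wedgeSetoid X x)
  by_cases hmk : m = k
  · subst hmk
    exact Or.inl (by rw [Function.update_injective x m h])
  · refine Or.inr ⟨?_, ?_⟩
    · simpa [Function.update_of_ne hmk] using congrFun h m
    · simpa [Function.update_of_ne (Ne.symm hmk)] using (congrFun h k).symm

/-- The map `σ` is a topological embedding, so that the wedge may be regarded as the subspace
`range σ` of the product. -/
theorem isEmbedding_toProd [∀ m, TopologicalSpace (X m)] : Topology.IsEmbedding (toProd X x) := by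
  refine ⟨⟨le_antisymm (toProd X x).continuous.le_induced fun U hU => ?_⟩, toProdFun_injective⟩
  obtain ⟨h1, h2⟩ := isOpen_iff.1 hU
  by_cases hb : base X x ∈ U
  · refine ⟨Set.pi {m | ¬ Set.range (incl X x m) ⊆ U} fun m => incl X x m ⁻¹' U,
      isOpen_set_pi (h2 hb) fun m _ => h1 m, ?_⟩
    ext w
    obtain ⟨m, a, rfl⟩ := exists_incl w
    change (∀ k, _ → incl X x k (Function.update x m a k) ∈ U) ↔ incl X x m a ∈ U
    constructor
    · intro h
      by_cases hm : Set.range (incl X x m) ⊆ U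
      · exact hm ⟨a, rfl⟩
      · simpa using h m hm
    · intro h k _
      by_cases hk : k = m
      · subst hk; simpa using h
      · rw [Function.update_of_ne hk, incl_base]; exact hb
  · refine ⟨⋃ m, (fun p : ∀ m, X m => p m) ⁻¹' (incl X x m ⁻¹' U),
      isOpen_iUnion fun m => (h1 m).preimage (continuous_apply m), ?_⟩
    ext w
    obtain ⟨m, a, rfl⟩ := exists_incl w
    simp only [Set.mem_iUnion, Set.mem_preimage]
    change (∃ k, incl X x k (Function.update x m a k) ∈ U) ↔ incl X x m a ∈ U
    constructor
    · rintro ⟨k, hk⟩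
      by_cases hkm : k = m
      · subst hkm; simpa using hk
      · rw [Function.update_of_ne hkm, incl_base] at hk; exact absurd hk hb
    · intro h
      exact ⟨m, by simpa using h⟩

/-- The wedge regarded as a subspace of the product. -/
def image (X : ℕ → Type u) [∀ m, TopologicalSpace (X m)] (x : ∀ m, X m) : Set (∀ m, X m) :=
  Set.range (toProd X x)

theorem base_mem_image [∀ m, TopologicalSpace (X m)] : x ∈ image X x :=
  ⟨base X x, toProd_base⟩

instance [∀ m, TopologicalSpace (X m)] : Fact (x ∈ image X x) :=
  ⟨base_mem_image⟩

/-- The canonical homeomorphism from the wedge to its image in the product, as a continuous map. -/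
def toImage (X : ℕ → Type u) [∀ m, TopologicalSpace (X m)] (x : ∀ m, X m) :
    C(ShrinkingWedge X x, image X x) :=
  ⟨fun w => ⟨toProd X x w, w, rfl⟩, by fun_prop⟩

theorem toImage_base [∀ m, TopologicalSpace (X m)] :
    toImage X x (base X x) = ⟨x, base_mem_image⟩ :=
  Subtype.ext toProd_base

/-- The map of shrinking wedges induced by a sequence of based maps, which is `f m` on `X m`. -/
def map [∀ m, TopologicalSpace (X m)] [∀ m, TopologicalSpace (Y m)] (f : ∀ m, C(X m, Y m))
    (hf : ∀ m, f m (x m) = y m) : C(ShrinkingWedge X x, ShrinkingWedge Y y) where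
  toFun := Quotient.lift (fun a : Σ m, X m => incl Y y a.1 (f a.1 a.2)) (by
    rintro ⟨m, a⟩ ⟨k, b⟩ (h | ⟨h, h'⟩)
    · rw [h]
    · dsimp only at h h' ⊢
      rw [h, h', hf, hf, incl_base, incl_base])
  continuous_toFun := by
    refine continuous_def.2 fun V hV => isOpen_iff.2 ⟨fun m => ?_, fun hb => ?_⟩
    · exact ((isOpen_iff.1 hV).1 m).preimage (f m).continuous
    · have hb' : base Y y ∈ V := by
        have : incl Y y 0 (f 0 (x 0)) ∈ V := hb
        rwa [hf, incl_base] at this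
      refine ((isOpen_iff.1 hV).2 hb').subset fun m hm hc => hm ?_
      rintro _ ⟨a, rfl⟩
      exact hc ⟨f m a, rfl⟩

theorem map_incl [∀ m, TopologicalSpace (X m)] [∀ m, TopologicalSpace (Y m)]
    (f : ∀ m, C(X m, Y m)) (hf : ∀ m, f m (x m) = y m) (m : ℕ) (a : X m) :
    map f hf (incl X x m a) = incl Y y m (f m a) :=
  rfl

theorem map_base [∀ m, TopologicalSpace (X m)] [∀ m, TopologicalSpace (Y m)]
    (f : ∀ m, C(X m, Y m)) (hf : ∀ m, f m (x m) = y m) :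
    map f hf (base X x) = base Y y := by
  rw [base, map_incl, hf, incl_base]

theorem piMap_mapsTo_image [∀ m, TopologicalSpace (X m)] [∀ m, TopologicalSpace (Y m)]
    (f : ∀ m, C(X m, Y m)) (hf : ∀ m, f m (x m) = y m) :
    Set.MapsTo (ContinuousMap.piMap f) (image X x) (image Y y) := by
  rintro _ ⟨w, rfl⟩
  obtain ⟨m, a, rfl⟩ := exists_incl w
  refine ⟨incl Y y m (f m a), ?_⟩
  funext k
  change Function.update y m (f m a) k = f k (Function.update x m a k)
  by_cases hk : k = m
  · subst hk; simp
  · rw [Function.update_of_ne hk, Function.update_of_ne hk, hf]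

end ShrinkingWedge

end

/-! The sequence of the pair splits because `σ_#` has a natural section. Given loops `f m` in the `X
m`, run `f m` during the `m`-th of countably many slabs of the cube, cut along one coordinate `i`.
At every point at most one factor is away from its basepoint, so the result lies in the wedge. It is
continuous because the wedge carries the subspace topology of the product (`concat`). Since `n ≥ 2`,
classes can be multiplied along another coordinate `j ≠ i`, where the construction commutes with
concatenation; hence the section is a homomorphism (`concatClass_mul`).

Exactness identifies the kernel of `σ_#` with the image of `∂` (`map_boundary`,
`exists_boundary_eq`). For injectivity of `∂` (`boundary_injective`), an element of its kernel is
represented by a cube in the product with its whole boundary at the basepoint. Stretching each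
component into its own slab deforms this cube into the wedge, where it represents the trivial
relative class.

Thus `(α, γ) ↦ ∂α · s(γ)`, with `s` the section, is bijective (`splittingHom_bijective`). `Φ` is its
inverse, transported from the image in the product to the wedge itself. -/

noncomputable section

/-! ### Homotopies relative to the boundary, and functoriality of homotopy groups. -/

namespace GenLoop

variable {N X : Type*} [TopologicalSpace X] {x : X}

/-- A homotopy that is constant on the boundary of the cube makes its two ends homotopic. -/
theorem homotopic_of_continuousMap {f g : Ω^ N X x} (F : C(I × (I^N), X))
    (h0 : ∀ y, F (0, y) = f y) (h1 : ∀ y, F (1, y) = g y)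
    (hb : ∀ s, ∀ y ∈ Cube.boundary N, F (s, y) = x) : Homotopic f g :=
  ⟨⟨⟨F, h0, h1⟩, fun s y hy => (hb s y hy).trans (f.2 y hy).symm⟩⟩

theorem Homotopic.exists_continuousMap {f g : Ω^ N X x} (h : Homotopic f g) :
    ∃ F : C(I × (I^N), X), (∀ y, F (0, y) = f y) ∧ (∀ y, F (1, y) = g y) ∧
      ∀ s, ∀ y ∈ Cube.boundary N, F (s, y) = x := by
  obtain ⟨H⟩ := h
  exact ⟨H.toContinuousMap, H.apply_zero, H.apply_one,
    fun s y hy => (H.eq_fst s hy).trans (f.2 y hy)⟩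

end GenLoop

namespace HomotopyGroup

variable {N X Y Z : Type*} [TopologicalSpace X] [TopologicalSpace Y] [TopologicalSpace Z]
  {x : X} {y : Y} {z : Z}

theorem map_map (φ : C(X, Y)) (h : φ x = y) (ψ : C(Y, Z)) (k : ψ y = z)
    (a : HomotopyGroup N X x) :
    map ψ k (map φ h a) = map (ψ.comp φ) ((congrArg ψ h).trans k) a := by
  induction a using Quotient.inductionOn
  rfl

theorem map_id (h : ContinuousMap.id X x = x) (a : HomotopyGroup N X x) :
    map (ContinuousMap.id X) h a = a := by
  induction a using Quotient.inductionOn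
  rfl

theorem map_congr {φ ψ : C(X, Y)} (e : φ = ψ) (h : φ x = y) (k : ψ x = y)
    (a : HomotopyGroup N X x) : map φ h a = map ψ k a := by
  subst e
  rfl

theorem map_mul [DecidableEq N] [Nonempty N] (φ : C(X, Y)) (h : φ x = y)
    (a b : HomotopyGroup N X x) : map φ h (a * b) = map φ h a * map φ h b := by
  induction a using Quotient.inductionOn with | _ p
  induction b using Quotient.inductionOn with | _ q
  have h1 := mul_spec (i := Classical.arbitrary N) (p := p) (q := q)
  refine (congrArg (map φ h) h1).trans (Eq.trans ?_ (mul_spec (i := Classical.arbitrary N)).symm)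
  refine congrArg (Quotient.mk _) (GenLoop.ext _ _ fun t => ?_)
  change φ (GenLoop.transAt _ q p t) = _
  simp only [GenLoop.transAt, GenLoop.coe_copy]
  split_ifs <;> rfl

/-- The homomorphism of homotopy groups induced by a based map. -/
def mapHom [DecidableEq N] [Nonempty N] (φ : C(X, Y)) (h : φ x = y) :
    HomotopyGroup N X x →* HomotopyGroup N Y y :=
  MonoidHom.mk' (map φ h) (map_mul φ h)

/-- The isomorphism of homotopy groups induced by a based homeomorphism. -/
def mapEquiv [DecidableEq N] [Nonempty N] (φ : X ≃ₜ Y) (h : φ x = y) :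
    HomotopyGroup N X x ≃* HomotopyGroup N Y y where
  toFun := map φ h
  invFun := map φ.symm (φ.symm_apply_eq.2 h.symm)
  left_inv a := by
    rw [map_map]
    exact (map_congr φ.symm_comp_toContinuousMap _ rfl a).trans (map_id rfl a)
  right_inv a := by
    rw [map_map]
    exact (map_congr φ.toContinuousMap_comp_symm _ rfl a).trans (map_id rfl a)
  map_mul' := map_mul _ _

end HomotopyGroup

/-! ### The boundary map and exactness at the homotopy group of the subspace. -/

namespace RelHomotopyGroup

variable {N X : Type*} [TopologicalSpace X] {A : Set X} {x : X}

/-- Evaluation at the starting point. -/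
def _root_.RelPathSpace.eval₀ (A : Set X) (x : X) : C(RelPathSpace A x, A) :=
  ⟨fun γ => ⟨γ.1 0, γ.2.1⟩, by fun_prop⟩

/-- The group law on relative classes is transported from the path space, so this factorization
makes the boundary map multiplicative. -/
theorem boundary_eq_map_eval₀ (hx : x ∈ A) (a : RelHomotopyGroup N A x) :
    boundary hx a = HomotopyGroup.map (RelPathSpace.eval₀ A x) rfl
      (relHomotopyGroupEquiv N hx a) := by
  induction a using Quotient.inductionOn
  rfl

theorem equiv_mul [DecidableEq N] [Nonempty N] [hx : Fact (x ∈ A)]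
    (a b : RelHomotopyGroup N A x) :
    relHomotopyGroupEquiv N hx.out (a * b) =
      relHomotopyGroupEquiv N hx.out a * relHomotopyGroupEquiv N hx.out b :=
  (relHomotopyGroupEquiv N hx.out).apply_symm_apply _

theorem boundary_mul [DecidableEq N] [Nonempty N] [hx : Fact (x ∈ A)]
    (a b : RelHomotopyGroup N A x) :
    boundary hx.out (a * b) = boundary hx.out a * boundary hx.out b := by
  simp only [boundary_eq_map_eval₀, equiv_mul, HomotopyGroup.map_mul]
  rfl

/-- The boundary map as a group homomorphism. -/
def boundaryHom (N : Type*) [DecidableEq N] [Nonempty N] (A : Set X) (x : X) [hx : Fact (x ∈ A)] :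
    RelHomotopyGroup N A x →* HomotopyGroup N A ⟨x, hx.out⟩ :=
  MonoidHom.mk' (boundary hx.out) boundary_mul

/-- The constant relative cube. -/
def _root_.RelCube.const (N : Type*) (hx : x ∈ A) : RelCube N A x :=
  ⟨ContinuousMap.const _ x, fun _ => hx, fun _ => rfl, fun _ _ _ => rfl⟩

/-- Exactness at `π_n(A)`: the composition of the boundary map with the inclusion is trivial. -/
theorem map_boundary [DecidableEq N] [Nonempty N] (hx : x ∈ A) (a : RelHomotopyGroup N A x) :
    HomotopyGroup.map (⟨Subtype.val, continuous_subtype_val⟩ : C(A, X)) rfl (boundary hx a) =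
      (1 : HomotopyGroup N X x) := by
  induction a using Quotient.inductionOn with | _ f
  refine Quotient.sound (s := GenLoop.Homotopic.setoid N x) ?_
  -- The last coordinate of the relative cube serves as the time of a null-homotopy.
  refine GenLoop.homotopic_of_continuousMap ⟨fun p => f.1 (p.2, p.1), by fun_prop⟩
    (fun y => rfl) (fun y => f.2.2.1 y) (fun s y hy => f.2.2.2 y hy s)

/-- Exactness at `π_n(A)`: a class that becomes trivial in `X` is a boundary. -/
theorem exists_boundary_eq [DecidableEq N] [Nonempty N] (hx : x ∈ A)
    (b : HomotopyGroup N A ⟨x, hx⟩)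
    (hb : HomotopyGroup.map (⟨Subtype.val, continuous_subtype_val⟩ : C(A, X)) rfl b =
      (1 : HomotopyGroup N X x)) :
    ∃ a : RelHomotopyGroup N A x, boundary hx a = b := by
  induction b using Quotient.inductionOn with | _ f
  obtain ⟨F, h0, h1, hF⟩ := GenLoop.Homotopic.exists_continuousMap
    (Quotient.exact (s := GenLoop.Homotopic.setoid N x) hb)
  have h0' : ∀ y, F (0, y) = f y := h0
  -- Conversely, a null-homotopy in `X` is a relative cube once its time is read as the last
  -- coordinate.
  refine ⟨Quotient.mk _ ⟨⟨fun p => F (p.2, p.1), by fun_prop⟩, fun y => ?_, fun y => h1 y,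
    fun y hy t => hF t y hy⟩, congrArg (Quotient.mk _) (GenLoop.ext _ _ fun y => ?_)⟩
  · change F (0, y) ∈ A
    rw [h0']
    exact (f y).2
  · exact Subtype.ext (h0' y)

/-- A relative cube whose face in `A` is null-homotopic in `A` is homotopic to a relative cube that
maps the whole boundary to the basepoint. -/
theorem exists_homotopic_of_boundary_eq_one [DecidableEq N] [Nonempty N] (hx : x ∈ A)
    (f : RelCube N A x)
    (hf : boundary hx (Quotient.mk _ f) = (1 : HomotopyGroup N A ⟨x, hx⟩)) :
    ∃ g : RelCube N A x, f ≈ g ∧ ∀ y, g.1 (y, 0) = x := by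
  obtain ⟨F, h0, h1, hF⟩ := GenLoop.Homotopic.exists_continuousMap
    (Quotient.exact (s := GenLoop.Homotopic.setoid N (⟨x, hx⟩ : A)) hf)
  have h0' : ∀ y, (F (0, y) : X) = f.1 (y, 0) := fun y => congrArg Subtype.val (h0 y)
  have h1' : ∀ y, (F (1, y) : X) = x := fun y => congrArg Subtype.val (h1 y)
  have hF' : ∀ s, ∀ y ∈ Cube.boundary N, (F (s, y) : X) = x :=
    fun s y hy => congrArg Subtype.val (hF s y hy)
  let pr : ℝ → I := Set.projIcc 0 1 zero_le_one
  have hpr : Continuous pr := continuous_projIcc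
  have pr0 : ∀ r : ℝ, r ≤ 0 → pr r = 0 := fun r h => Set.projIcc_of_le_left _ h
  have pr1 : ∀ r : ℝ, 1 ≤ r → pr r = 1 := fun r h => Set.projIcc_of_right_le _ h
  -- The null-homotopy `F` of the face, run backwards over `[-1, 0]`, is glued to `f` over `[0, 1]`.
  let K : C((I^N) × ℝ, X) :=
    ⟨fun p => if p.2 ≤ 0 then (F (pr (-p.2), p.1) : X) else f.1 (p.1, pr p.2), by
      refine Continuous.if_le (by fun_prop) (by fun_prop) (by fun_prop) (by fun_prop) ?_
      rintro ⟨y, r⟩ h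
      dsimp only at h ⊢
      rw [h, neg_zero, pr0 0 le_rfl, h0']⟩
  have Kneg : ∀ y r, r ≤ 0 → K (y, r) = F (pr (-r), y) := fun y r h => if_pos h
  have Kpos : ∀ y r, 0 ≤ r → K (y, r) = f.1 (y, pr r) := by
    intro y r h
    rcases h.eq_or_lt with rfl | h
    · rw [Kneg _ _ le_rfl, neg_zero, pr0 0 le_rfl, h0']
    · exact if_neg h.not_ge
  -- Stage `s` traverses `K` over `[-s, 1]`. Its initial face is `F (s, ·)`, which stays in `A` and
  -- is constant at `s = 1`.
  let H : C(I × ((I^N) × I), X) :=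
    ⟨fun p => K (p.2.1, (p.2.2 : ℝ) * (1 + p.1) - p.1), by fun_prop⟩
  have hH : ∀ s : I, IsRelCube A x ⟨fun z => H (s, z), by fun_prop⟩ := by
    refine fun s => ⟨fun y => ?_, fun y => ?_, fun y hy t => ?_⟩
    · change K (y, ((0 : I) : ℝ) * (1 + s) - s) ∈ A
      rw [Kneg _ _ (by simpa using s.2.1)]
      exact (F _).2
    · change K (y, ((1 : I) : ℝ) * (1 + s) - s) = x
      rw [Kpos _ _ (by simp), pr1 _ (by simp), f.2.2.1]
    · change K (y, _) = x
      rcases le_total ((t : ℝ) * (1 + s) - s) 0 with h | h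
      · rw [Kneg _ _ h, hF' _ _ hy]
      · rw [Kpos _ _ h, f.2.2.2 _ hy]
  refine ⟨⟨⟨fun z => H (1, z), by fun_prop⟩, hH 1⟩, ⟨⟨⟨H, ?_, fun _ => rfl⟩, hH⟩⟩, fun y => ?_⟩
  · rintro ⟨y, t⟩
    change K (y, (t : ℝ) * (1 + (0 : I)) - (0 : I)) = f.1 (y, t)
    rw [Kpos _ _ (by simpa using t.2.1)]
    simp [pr]
  · change K (y, ((0 : I) : ℝ) * (1 + (1 : I)) - (1 : I)) = x
    rw [Kneg _ _ (by simp), pr1 _ (by simp), h1']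

end RelHomotopyGroup
-- Reparametrizations of the cube supported in successive slabs.
namespace Cube

/-- The map `I → I` that stretches the interval `[1 - 2⁻ᵐ, 1 - 2⁻ᵐ⁻¹]` onto `I` and is constant on
both sides of it. -/
def stretch (m : ℕ) : C(I, I) :=
  ⟨fun t => Set.projIcc 0 1 zero_le_one (2 ^ (m + 1) * ((t : ℝ) - 1) + 2), by
    exact continuous_projIcc.comp (by fun_prop)⟩

theorem stretch_zero (m : ℕ) : stretch m 0 = 0 := by
  refine Set.projIcc_of_le_left zero_le_one ?_
  have : (1 : ℝ) ≤ 2 ^ m := one_le_pow₀ one_le_two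
  simp only [Set.Icc.coe_zero, pow_succ]
  linarith

theorem stretch_one (m : ℕ) : stretch m 1 = 1 :=
  Set.projIcc_of_right_le zero_le_one (by simp)

/-- The interval stretched by `m` ends no later than the one stretched by `k` begins. -/
theorem stretch_eq_zero_or_one {m k : ℕ} (h : m < k) (t : I) :
    (stretch m t = 1) ∨ (stretch k t = 0) := by
  by_cases hm : 1 ≤ 2 ^ (m + 1) * ((t : ℝ) - 1) + 2
  · exact Or.inl (Set.projIcc_of_right_le zero_le_one hm)
  · refine Or.inr (Set.projIcc_of_le_left zero_le_one ?_)
    -- As `t - 1 ≤ 0`, doubling the factor turns `2 ^ (m + 1) * (t - 1) < -1` into `2 ^ (k + 1) * (t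
    -- - 1) < -2`.
    have h1 : (2 : ℝ) * 2 ^ (m + 1) ≤ 2 ^ (k + 1) := by
      rw [← pow_succ']
      exact pow_le_pow_right₀ one_le_two (by omega)
    have h2 : (t : ℝ) ≤ 1 := t.2.2
    nlinarith

/-- At each point at most one of the maps `stretch m` takes a value other than `0` and `1`. -/
theorem exists_stretch_eq (t : I) : ∃ m, ∀ k, k ≠ m → stretch k t = 0 ∨ stretch k t = 1 := by
  by_cases h : ∃ m, ¬ (stretch m t = 0 ∨ stretch m t = 1)
  · obtain ⟨m, hm⟩ := h
    refine ⟨m, fun k hk => ?_⟩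
    rcases lt_or_gt_of_ne hk with h | h
    · exact (stretch_eq_zero_or_one h t).elim Or.inr fun h' => absurd (Or.inl h') hm
    · exact (stretch_eq_zero_or_one h t).elim (fun h' => absurd (Or.inr h') hm) Or.inl
  · push Not at h
    exact ⟨0, fun k _ => h k⟩

/-- The straight-line homotopy from the identity to `stretch m`. -/
def stretchHomotopy (m : ℕ) : C(I × I, I) :=
  ⟨fun p => ⟨(1 - (p.1 : ℝ)) * p.2 + p.1 * stretch m p.2,
    (convex_Icc (0 : ℝ) 1) p.2.2 (stretch m p.2).2 (sub_nonneg.2 p.1.2.2) p.1.2.1 (by ring)⟩,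
    by fun_prop⟩

variable {N : Type*} [DecidableEq N]

/-- The homotopy from the identity of the cube to `stretch m` in the coordinate `i`. -/
def stretchAt (i : N) (m : ℕ) : C(I × (I^N), I^N) :=
  ⟨fun p => Function.update p.2 i (stretchHomotopy m (p.1, p.2 i)), by fun_prop⟩

theorem stretchAt_zero (i : N) (m : ℕ) (y : I^N) : stretchAt i m (0, y) = y := by
  have : stretchHomotopy m (0, y i) = y i := Subtype.ext (by simp [stretchHomotopy])
  change Function.update y i (stretchHomotopy m (0, y i)) = y
  rw [this, Function.update_eq_self]

theorem stretchAt_one (i : N) (m : ℕ) (y : I^N) :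
    stretchAt i m (1, y) = Function.update y i (stretch m (y i)) := by
  have : stretchHomotopy m (1, y i) = stretch m (y i) := Subtype.ext (by simp [stretchHomotopy])
  change Function.update y i (stretchHomotopy m (1, y i)) = _
  rw [this]

theorem stretchAt_mem_boundary (i : N) (m : ℕ) (s : I) {y : I^N} (hy : y ∈ boundary N) :
    stretchAt i m (s, y) ∈ boundary N := by
  obtain ⟨j, hj⟩ := hy
  refine ⟨j, ?_⟩
  change Function.update y i (stretchHomotopy m (s, y i)) j = 0 ∨
    Function.update y i (stretchHomotopy m (s, y i)) j = 1
  by_cases hji : j = i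
  · subst hji
    rw [Function.update_self]
    rcases hj with hj | hj <;> rw [hj]
    · exact Or.inl (Subtype.ext (by simp [stretchHomotopy, stretch_zero]))
    · exact Or.inr (Subtype.ext (by simp [stretchHomotopy, stretch_one]))
  · rwa [Function.update_of_ne hji]

theorem exists_stretchAt_mem_boundary (i : N) (y : I^N) :
    ∃ m, ∀ k, k ≠ m → stretchAt i k (1, y) ∈ boundary N := by
  obtain ⟨m, hm⟩ := exists_stretch_eq (y i)
  refine ⟨m, fun k hk => ⟨i, ?_⟩⟩
  rw [stretchAt_one, Function.update_self]
  exact hm k hk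

theorem stretchAt_update {i j : N} (h : i ≠ j) (m : ℕ) (s : I) (y : I^N) (t : I) :
    stretchAt i m (s, Function.update y j t) = Function.update (stretchAt i m (s, y)) j t := by
  change Function.update (Function.update y j t) i (stretchHomotopy m (s, Function.update y j t i))
    = Function.update (Function.update y i _) j t
  rw [Function.update_of_ne h, Function.update_comm h]

end Cube

/-! ### Infinite concatenation in the wedge, and injectivity of the boundary map. -/

namespace ShrinkingWedge

variable {X Y : ℕ → Type u} [∀ m, TopologicalSpace (X m)] [∀ m, TopologicalSpace (Y m)]
  {x : ∀ m, X m} {y : ∀ m, Y m}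

theorem mem_image_of_forall_ne {p : ∀ m, X m} (h : ∃ m, ∀ k, k ≠ m → p k = x k) :
    p ∈ image X x := by
  obtain ⟨m, hm⟩ := h
  refine ⟨incl X x m (p m), funext fun k => ?_⟩
  change Function.update x m (p m) k = p k
  by_cases hk : k = m
  · subst hk; simp
  · rw [Function.update_of_ne hk, hm k hk]

theorem exists_mk_eq {N : Type*} (a : ∀ m, HomotopyGroup N (X m) (x m)) :
    ∃ f : ∀ m, Ω^ N (X m) (x m), (fun m => Quotient.mk _ (f m)) = a :=
  ⟨fun m => (a m).out, funext fun m => (a m).out_eq⟩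

/-- The map of images in the products induced by a sequence of based maps. -/
def imageMap (f : ∀ m, C(X m, Y m)) (hf : ∀ m, f m (x m) = y m) : C(image X x, image Y y) :=
  ⟨fun p => ⟨ContinuousMap.piMap f p, piMap_mapsTo_image f hf p.2⟩, by fun_prop⟩

theorem imageMap_base (f : ∀ m, C(X m, Y m)) (hf : ∀ m, f m (x m) = y m) :
    imageMap f hf ⟨x, base_mem_image⟩ = ⟨y, base_mem_image⟩ :=
  Subtype.ext (funext hf)

theorem map_boundary {N : Type*} (f : ∀ m, C(X m, Y m)) (hf : ∀ m, f m (x m) = y m)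
    (a : RelHomotopyGroup N (image X x) x) :
    HomotopyGroup.map (imageMap f hf) (imageMap_base f hf)
        (RelHomotopyGroup.boundary base_mem_image a) =
      RelHomotopyGroup.boundary base_mem_image (RelHomotopyGroup.map (ContinuousMap.piMap f)
        (piMap_mapsTo_image f hf) (funext hf) a) := by
  induction a using Quotient.inductionOn
  rfl

variable {N : Type*} [DecidableEq N]

/-- The infinite concatenation, along the coordinate `i`, of loops in the spaces `X m`. -/
def concat (i : N) (f : ∀ m, Ω^ N (X m) (x m)) :
    Ω^ N (image X x) ⟨x, base_mem_image⟩ :=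
  ⟨⟨fun z => ⟨fun m => f m (Cube.stretchAt i m (1, z)), mem_image_of_forall_ne <| by
      obtain ⟨m, hm⟩ := Cube.exists_stretchAt_mem_boundary i z
      exact ⟨m, fun k hk => (f k).2 _ (hm k hk)⟩⟩, by
      refine Continuous.subtype_mk (continuous_pi fun m => (f m).1.continuous.comp ?_) _
      fun_prop⟩,
    fun z hz => Subtype.ext (funext fun m => (f m).2 _ (Cube.stretchAt_mem_boundary i m 1 hz))⟩

/-- Infinitely many homotopies can be run at once: continuity in the product is checked in each
factor, and the slabs keep every stage inside the wedge. -/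
theorem concat_homotopic (i : N) {f g : ∀ m, Ω^ N (X m) (x m)}
    (h : ∀ m, GenLoop.Homotopic (f m) (g m)) : GenLoop.Homotopic (concat i f) (concat i g) := by
  choose F h0 h1 hF using fun m => (h m).exists_continuousMap
  refine GenLoop.homotopic_of_continuousMap
    ⟨fun p => ⟨fun m => F m (p.1, Cube.stretchAt i m (1, p.2)), mem_image_of_forall_ne ?_⟩,
      Continuous.subtype_mk (continuous_pi fun m => by fun_prop) _⟩
    (fun z => Subtype.ext (funext fun m => h0 m _)) (fun z => Subtype.ext (funext fun m => h1 m _))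
    (fun s z hz => Subtype.ext (funext fun m =>
      hF m s _ (Cube.stretchAt_mem_boundary i m 1 hz)))
  obtain ⟨m, hm⟩ := Cube.exists_stretchAt_mem_boundary i p.2
  exact ⟨m, fun k hk => hF k _ _ (hm k hk)⟩

/-- Stretching in direction `i` leaves the coordinate `j` alone, so the two operations commute on
the nose. -/
theorem concat_transAt {i j : N} (h : i ≠ j) (f g : ∀ m, Ω^ N (X m) (x m)) :
    concat i (fun m => GenLoop.transAt j (f m) (g m)) =
      GenLoop.transAt j (concat i f) (concat i g) := by
  refine GenLoop.ext _ _ fun z => Subtype.ext (funext fun m => ?_)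
  change GenLoop.transAt j (f m) (g m) (Cube.stretchAt i m (1, z)) = _
  have hz : Cube.stretchAt i m (1, z) j = z j := Function.update_of_ne h.symm _ _
  simp only [GenLoop.transAt, GenLoop.coe_copy, hz]
  split_ifs
  · change _ = f m (Cube.stretchAt i m (1, Function.update z j _))
    rw [Cube.stretchAt_update h]
  · change _ = g m (Cube.stretchAt i m (1, Function.update z j _))
    rw [Cube.stretchAt_update h]

/-- The class of the infinite concatenation of representatives of a family of classes. -/
def concatClass (i : N) (a : ∀ m, HomotopyGroup N (X m) (x m)) :
    HomotopyGroup N (image X x) ⟨x, base_mem_image⟩ :=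
  Quotient.mk _ (concat i fun m => (a m).out)

/-- Independence of the representatives picked by `Quotient.out`. -/
theorem concatClass_mk (i : N) (f : ∀ m, Ω^ N (X m) (x m)) :
    concatClass (x := x) i (fun m => Quotient.mk _ (f m)) = Quotient.mk _ (concat i f) :=
  Quotient.sound (s := GenLoop.Homotopic.setoid N _)
    (concat_homotopic i fun m => Quotient.mk_out (f m))

theorem concatClass_mul [Nonempty N] {i j : N} (h : i ≠ j)
    (a b : ∀ m, HomotopyGroup N (X m) (x m)) :
    concatClass i (a * b) = concatClass i a * concatClass i b := by
  obtain ⟨f, rfl⟩ := exists_mk_eq a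
  obtain ⟨g, rfl⟩ := exists_mk_eq b
  rw [concatClass_mk, concatClass_mk]
  refine Eq.trans ?_ (HomotopyGroup.mul_spec (i := j)).symm
  rw [← concat_transAt h, ← concatClass_mk]
  exact congrArg _ (funext fun m => HomotopyGroup.mul_spec (i := j))

theorem map_concatClass (i : N) (f : ∀ m, C(X m, Y m)) (hf : ∀ m, f m (x m) = y m)
    (a : ∀ m, HomotopyGroup N (X m) (x m)) :
    HomotopyGroup.map (imageMap f hf) (imageMap_base f hf) (concatClass i a) =
      concatClass i fun m => HomotopyGroup.map (f m) (hf m) (a m) := by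
  obtain ⟨g, rfl⟩ := exists_mk_eq a
  rw [concatClass_mk]
  let fg : ∀ m, Ω^ N (Y m) (y m) := fun m =>
    ⟨(f m).comp (g m).1, fun z hz => (congrArg (f m) ((g m).2 z hz)).trans (hf m)⟩
  exact Eq.trans rfl (concatClass_mk i fg).symm

/-- The coordinate projection, restricted to the wedge in the product. -/
def proj (X : ℕ → Type u) [∀ m, TopologicalSpace (X m)] (x : ∀ m, X m) (m : ℕ) :
    C(image X x, X m) :=
  ⟨fun p => p.1 m, (continuous_apply m).comp continuous_subtype_val⟩

/-- The `m`-th component of the concatenation is `f m` precomposed with a stretching, and this is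
homotopic to the identity through maps preserving the boundary of the cube. -/
theorem map_proj_concatClass (i : N) (a : ∀ m, HomotopyGroup N (X m) (x m)) (m : ℕ) :
    HomotopyGroup.map (proj X x m) rfl (concatClass i a) = a m := by
  obtain ⟨f, rfl⟩ := exists_mk_eq a
  rw [concatClass_mk]
  refine Quotient.sound (s := GenLoop.Homotopic.setoid N _) (GenLoop.Homotopic.symm ?_)
  exact GenLoop.homotopic_of_continuousMap ((f m).1.comp (Cube.stretchAt i m))
    (fun z => congrArg (f m) (Cube.stretchAt_zero i m z)) (fun z => rfl)
    (fun s z hz => (f m).2 _ (Cube.stretchAt_mem_boundary i m s hz))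

/-- Null-homotopies of all the components assemble into one in the product. -/
theorem map_val_eq_one [Nonempty N] (b : HomotopyGroup N (image X x) ⟨x, base_mem_image⟩)
    (h : ∀ m, HomotopyGroup.map (proj X x m) rfl b = (1 : HomotopyGroup N (X m) (x m))) :
    HomotopyGroup.map (⟨Subtype.val, continuous_subtype_val⟩ : C(image X x, ∀ m, X m)) rfl b =
      (1 : HomotopyGroup N (∀ m, X m) x) := by
  induction b using Quotient.inductionOn with | _ f
  choose F h0 h1 hF using fun m =>
    (Quotient.exact (s := GenLoop.Homotopic.setoid N _) (h m)).exists_continuousMap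
  refine Quotient.sound (s := GenLoop.Homotopic.setoid N x) ?_
  exact GenLoop.homotopic_of_continuousMap ⟨fun p m => F m p, by fun_prop⟩
    (fun z => funext fun m => h0 m z) (fun z => funext fun m => h1 m z)
    (fun s z hz => funext fun m => hF m s z hz)

theorem boundary_injective (N : Type*) [DecidableEq N] [Nonempty N] :
    Function.Injective (RelHomotopyGroup.boundaryHom N (image X x) x) := by
  refine (injective_iff_map_eq_one _).2 fun a ha => ?_
  induction a using Quotient.inductionOn with | _ f
  obtain ⟨g, hfg, hg⟩ :=
    RelHomotopyGroup.exists_homotopic_of_boundary_eq_one base_mem_image f ha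
  let i : N := Classical.arbitrary N
  have hgm : ∀ z t m, z ∈ Cube.boundary N → g.1 (z, t) m = x m := fun z t m hz =>
    congrFun (g.2.2.2 z hz t) m
  -- Each component is stretched into its own slab along `i`. The boundary remains at the basepoint
  -- throughout, and at time `1` the entire cube lies in the wedge.
  let F : C(I × ((I^N) × I), ∀ m, X m) :=
    ⟨fun p m => g.1 (Cube.stretchAt i m (p.1, p.2.1), p.2.2) m, by
      refine continuous_pi fun m => (continuous_apply m).comp (g.1.continuous.comp ?_)
      fun_prop⟩
  have hF : ∀ s, (∀ z, F (s, (z, 0)) = x) ∧ (∀ z, F (s, (z, 1)) = x) ∧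
      ∀ z ∈ Cube.boundary N, ∀ t, F (s, (z, t)) = x := fun s =>
    ⟨fun z => funext fun m => congrFun (hg _) m, fun z => funext fun m => congrFun (g.2.2.1 _) m,
      fun z hz t => funext fun m => hgm _ _ _ (Cube.stretchAt_mem_boundary i m s hz)⟩
  have hF1 : ∀ z, F (1, z) ∈ image X x := by
    rintro ⟨z, t⟩
    obtain ⟨m, hm⟩ := Cube.exists_stretchAt_mem_boundary i z
    exact mem_image_of_forall_ne ⟨m, fun k hk => hgm _ _ _ (hm k hk)⟩
  let k : RelCube N (image X x) x := ⟨⟨fun z => F (1, z), by fun_prop⟩, fun z => hF1 _,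
    (hF 1).2.1, (hF 1).2.2⟩
  have hgk : g ≈ k := by
    refine ⟨⟨⟨F, fun z => funext fun m => ?_, fun z => rfl⟩, fun s => ⟨fun z => ?_,
      (hF s).2.1, (hF s).2.2⟩⟩⟩
    · change g.1 (Cube.stretchAt i m (0, z.1), z.2) m = _
      rw [Cube.stretchAt_zero]
    · exact (congrArg (· ∈ image X x) ((hF s).1 z)).mpr base_mem_image
  -- Raising the last coordinate to at least `s` contracts `k` onto its final face. The moving
  -- initial face is allowed because `k` takes all its values in the wedge.
  have hk : k ≈ RelCube.const N base_mem_image := by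
    refine ⟨⟨⟨⟨fun p => F (1, (p.2.1, p.2.2 ⊔ p.1)), by fun_prop⟩, fun z => ?_, fun z => ?_⟩,
      fun s => ⟨fun z => hF1 _, fun z => ?_, fun z hz t => (hF 1).2.2 z hz _⟩⟩⟩
    · change F (1, (z.1, z.2 ⊔ 0)) = F (1, z)
      rw [sup_of_le_left (unitInterval.nonneg' : 0 ≤ z.2)]
    · change F (1, (z.1, z.2 ⊔ 1)) = x
      rw [sup_of_le_right (unitInterval.le_one' : z.2 ≤ 1), (hF 1).2.1]
    · change F (1, (z, 1 ⊔ s)) = x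
      rw [sup_of_le_left (unitInterval.le_one' : s ≤ 1), (hF 1).2.1]
  exact Quotient.sound (Setoid.trans hfg (Setoid.trans hgk hk))

end ShrinkingWedge
-- Assembly of the splitting.
namespace ShrinkingWedge

variable {X Y : ℕ → Type u} [∀ m, TopologicalSpace (X m)] [∀ m, TopologicalSpace (Y m)]
  {x : ∀ m, X m} {y : ∀ m, Y m}

section

variable {N : Type*} [DecidableEq N] [Nontrivial N]

/-- The isomorphism of the homotopy groups of the wedge and of its image in the product. -/
def imageEquiv (N : Type*) [DecidableEq N] [Nonempty N] (X : ℕ → Type u)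
    [∀ m, TopologicalSpace (X m)] (x : ∀ m, X m) :
    HomotopyGroup N (ShrinkingWedge X x) (base X x) ≃*
      HomotopyGroup N (image X x) ⟨x, base_mem_image⟩ :=
  HomotopyGroup.mapEquiv (isEmbedding_toProd (x := x)).toHomeomorph toImage_base

theorem imageEquiv_apply (b : HomotopyGroup N (ShrinkingWedge X x) (base X x)) :
    imageEquiv N X x b = HomotopyGroup.map (toImage X x) toImage_base b :=
  rfl

theorem imageEquiv_map (f : ∀ m, C(X m, Y m)) (hf : ∀ m, f m (x m) = y m)
    (b : HomotopyGroup N (ShrinkingWedge X x) (base X x)) :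
    imageEquiv N Y y (HomotopyGroup.map (map f hf) (map_base f hf) b) =
      HomotopyGroup.map (imageMap f hf) (imageMap_base f hf) (imageEquiv N X x b) := by
  rw [imageEquiv_apply, imageEquiv_apply, HomotopyGroup.map_map, HomotopyGroup.map_map]
  refine HomotopyGroup.map_congr (ContinuousMap.ext fun w => Subtype.ext ?_) _ _ b
  obtain ⟨m, a, rfl⟩ := exists_incl w
  funext k
  change Function.update y m (f m a) k = f k (Function.update x m a k)
  by_cases hk : k = m
  · subst hk; simp
  · rw [Function.update_of_ne hk, Function.update_of_ne hk, hf]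

/-- The homomorphism `(α, γ) ↦ ∂α · s(γ)`, where `s` is the section of `σ_#` given by infinite
concatenation. -/
def splittingHom (X : ℕ → Type u) [∀ m, TopologicalSpace (X m)] (x : ∀ m, X m) {i j : N}
    (h : i ≠ j) :
    RelHomotopyGroup N (image X x) x × (∀ m, HomotopyGroup N (X m) (x m)) →*
      HomotopyGroup N (image X x) ⟨x, base_mem_image⟩ :=
  MonoidHom.coprod (RelHomotopyGroup.boundaryHom N (image X x) x)
    (MonoidHom.mk' (concatClass i) (concatClass_mul h))

theorem splittingHom_apply {i j : N} (h : i ≠ j)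
    (p : RelHomotopyGroup N (image X x) x × (∀ m, HomotopyGroup N (X m) (x m))) :
    splittingHom X x h p =
      RelHomotopyGroup.boundary base_mem_image p.1 * concatClass i p.2 :=
  rfl

theorem map_proj_boundary (a : RelHomotopyGroup N (image X x) x) (m : ℕ) :
    HomotopyGroup.map (proj X x m) rfl (RelHomotopyGroup.boundary base_mem_image a) =
      (1 : HomotopyGroup N (X m) (x m)) := by
  have h := congrArg (HomotopyGroup.mapHom
    (ContinuousMap.eval m : C((∀ k, X k), X m)) (rfl : _ = x m))
    (RelHomotopyGroup.map_boundary base_mem_image a)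
  rw [map_one] at h
  refine Eq.trans ?_ h
  exact (HomotopyGroup.map_map
    (⟨Subtype.val, continuous_subtype_val⟩ : C(image X x, ∀ k, X k)) rfl
    (ContinuousMap.eval m : C((∀ k, X k), X m)) rfl _).symm

/-- Boundaries die in every factor, so only the section contributes; this recovers the second
component. -/
theorem map_proj_splittingHom {i j : N} (h : i ≠ j)
    (p : RelHomotopyGroup N (image X x) x × (∀ m, HomotopyGroup N (X m) (x m))) (m : ℕ) :
    HomotopyGroup.map (proj X x m) rfl (splittingHom X x h p) = p.2 m := by
  rw [splittingHom_apply, HomotopyGroup.map_mul]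
  exact (congrArg₂ (· * ·) (map_proj_boundary (x := x) p.1 m) (map_proj_concatClass (x := x) i p.2 m)).trans
    (one_mul _)

theorem splittingHom_bijective {i j : N} (h : i ≠ j) :
    Function.Bijective (splittingHom X x h) := by
  constructor
  · refine (injective_iff_map_eq_one _).2 ?_
    rintro ⟨a, g⟩ hp
    have hg : g = 1 := funext fun m => by
      have := map_proj_splittingHom h (a, g) m
      rw [hp] at this
      exact this.symm.trans (map_one (HomotopyGroup.mapHom (proj X x m) rfl))
    subst hg
    have ha : RelHomotopyGroup.boundaryHom N (image X x) x a = 1 := by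
      have h1 := MonoidHom.map_one (MonoidHom.mk' _ (concatClass_mul (X := X) (x := x) h))
      have h2 : RelHomotopyGroup.boundaryHom N (image X x) x a * concatClass i 1 = 1 := hp
      rwa [show concatClass (X := X) (x := x) i 1 = 1 from h1, mul_one] at h2
    rw [boundary_injective N (ha.trans (map_one _).symm)]
    rfl
  · intro b
    let g : ∀ m, HomotopyGroup N (X m) (x m) := fun m => HomotopyGroup.map (proj X x m) rfl b
    -- Dividing `b` by the section of its own projections leaves a class that is trivial in the
    -- product, hence a boundary.
    obtain ⟨a, ha⟩ := RelHomotopyGroup.exists_boundary_eq base_mem_image (b * (concatClass i g)⁻¹)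
      (map_val_eq_one _ fun m => by
        have h1 := map_mul (HomotopyGroup.mapHom (N := N) (proj X x m) rfl) b (concatClass i g)⁻¹
        refine h1.trans ?_
        rw [map_inv]
        exact mul_inv_eq_one.2 (map_proj_concatClass i g m).symm)
    refine ⟨(a, g), ?_⟩
    rw [splittingHom_apply, ha, inv_mul_cancel_right]

theorem splittingHom_natural {i j : N} (h : i ≠ j) (f : ∀ m, C(X m, Y m))
    (hf : ∀ m, f m (x m) = y m)
    (p : RelHomotopyGroup N (image X x) x × (∀ m, HomotopyGroup N (X m) (x m))) :
    splittingHom Y y h (RelHomotopyGroup.map (ContinuousMap.piMap f)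
        (piMap_mapsTo_image f hf) (funext hf) p.1, fun m => HomotopyGroup.map (f m) (hf m) (p.2 m)) =
      HomotopyGroup.map (imageMap f hf) (imageMap_base f hf) (splittingHom X x h p) := by
  rw [splittingHom_apply, splittingHom_apply, HomotopyGroup.map_mul, map_boundary,
    map_concatClass]

/-- The natural splitting of the homotopy groups of a shrinking wedge. -/
def splittingEquiv (X : ℕ → Type u) [∀ m, TopologicalSpace (X m)] (x : ∀ m, X m) {i j : N}
    (h : i ≠ j) :
    HomotopyGroup N (ShrinkingWedge X x) (base X x) ≃*
      RelHomotopyGroup N (image X x) x × ∀ m, HomotopyGroup N (X m) (x m) :=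
  (imageEquiv N X x).trans (MulEquiv.ofBijective _ (splittingHom_bijective h)).symm

theorem splittingHom_splittingEquiv {i j : N} (h : i ≠ j)
    (b : HomotopyGroup N (ShrinkingWedge X x) (base X x)) :
    splittingHom X x h (splittingEquiv X x h b) = imageEquiv N X x b :=
  (MulEquiv.ofBijective _ (splittingHom_bijective h)).apply_symm_apply _

end

end ShrinkingWedge
end

theorem mainTheorem5 (n : ℕ) [n.AtLeastTwo] :
    ∃ Φ : ∀ (X : ℕ → Type u) [∀ m, TopologicalSpace (X m)] [∀ m, PathConnectedSpace (X m)]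
        (x : ∀ m, X m),
        π_ n (ShrinkingWedge X x) (ShrinkingWedge.base X x) ≃*
          RelHomotopyGroup (Fin n) (ShrinkingWedge.image X x) x × ∀ m, π_ n (X m) (x m),
      -- naturality with respect to sequences of based maps
      (∀ (X Y : ℕ → Type u) [∀ m, TopologicalSpace (X m)] [∀ m, PathConnectedSpace (X m)]
          [∀ m, TopologicalSpace (Y m)] [∀ m, PathConnectedSpace (Y m)]
          (x : ∀ m, X m) (y : ∀ m, Y m) (f : ∀ m, C(X m, Y m)) (hf : ∀ m, f m (x m) = y m)
          (β : π_ n (ShrinkingWedge X x) (ShrinkingWedge.base X x)),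
        Φ Y y (HomotopyGroup.map (ShrinkingWedge.map f hf) (ShrinkingWedge.map_base f hf) β) =
          (RelHomotopyGroup.map (ContinuousMap.piMap f)
              (ShrinkingWedge.piMap_mapsTo_image f hf) (funext hf) (Φ X x β).1,
            fun m => HomotopyGroup.map (f m) (hf m) ((Φ X x β).2 m))) ∧
      (∀ (X : ℕ → Type u) [∀ m, TopologicalSpace (X m)] [∀ m, PathConnectedSpace (X m)]
          (x : ∀ m, X m),
        -- on the first summand, the inverse of the isomorphism is the boundary map `∂`
        (∀ α : RelHomotopyGroup (Fin n) (ShrinkingWedge.image X x) x,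
          HomotopyGroup.map (ShrinkingWedge.toImage X x) ShrinkingWedge.toImage_base
              ((Φ X x).symm (α, 1)) =
            RelHomotopyGroup.boundary ShrinkingWedge.base_mem_image α) ∧
        -- the projection onto the second summand is `σ_#`
        (∀ (β : π_ n (ShrinkingWedge X x) (ShrinkingWedge.base X x)) (m : ℕ),
          (Φ X x β).2 m =
            HomotopyGroup.map (ContinuousMap.eval m) rfl
              (HomotopyGroup.map (ShrinkingWedge.toProd X x) ShrinkingWedge.toProd_base β))) := by
  have : Nontrivial (Fin n) := Fin.nontrivial_iff_two_le.2 Nat.AtLeastTwo.prop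
  -- The coordinates are fixed before the spaces, so the same section is used for every sequence;
  -- naturality depends on this.
  obtain ⟨i, j, h⟩ := exists_pair_ne (Fin n)
  refine ⟨fun X _ _ x => ShrinkingWedge.splittingEquiv X x h, ?_, ?_⟩
  · intro X Y _ _ _ _ x y f hf β
    apply (ShrinkingWedge.splittingHom_bijective h).1
    rw [ShrinkingWedge.splittingHom_splittingEquiv, ShrinkingWedge.splittingHom_natural,
      ShrinkingWedge.splittingHom_splittingEquiv, ShrinkingWedge.imageEquiv_map]
  · intro X _ _ x
    refine ⟨fun α => ?_, fun β m => ?_⟩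
    · have h1 := ShrinkingWedge.splittingHom_splittingEquiv h
        ((ShrinkingWedge.splittingEquiv X x h).symm (α, 1))
      rw [MulEquiv.apply_symm_apply, ShrinkingWedge.imageEquiv_apply] at h1
      refine h1.symm.trans ?_
      rw [ShrinkingWedge.splittingHom, MonoidHom.coprod_apply, map_one, mul_one]
      rfl
    · rw [← ShrinkingWedge.map_proj_splittingHom h, ShrinkingWedge.splittingHom_splittingEquiv,
        ShrinkingWedge.imageEquiv_apply, HomotopyGroup.map_map, HomotopyGroup.map_map]
      rfl
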